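/- For $n\ge 0$ let $C_{2^n}=\{z\in\mathbb C: z^{2^n}=1\}$, let $\mathbb H$ be the algebra of real quaternions, which contains $\mathbb C$ as the subalgebra $\{x+yi : x,y\in\mathbb R\}$, and let $Q_8=\{\pm1,\pm i,\pm j,\pm k\}\subset\mathbb H$. For $n\ge 1$ let $Q_{2^n}$ be the subgroup of the multiplicative group $\mathbb H\setminus\{0\}$ generated by $C_{2^{n-1}}\cup Q_8$, and let $Q_{2^\infty}=\bigcup_{n\ge1}Q_{2^n}$ be the infinite group of generalized quaternions. Let $G$ be an infinite non-abelian group in which the order of every element is a power of $2$ and which contains exactly one element of order $2$. Then $G$ is isomorphic to $Q_{2^\infty}$. -/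

import Mathlib

open scoped Quaternion

noncomputable section

/-- The cyclic group `C_{2^n} = {z ∈ ℂ : z^(2^n) = 1}`, as a set of complex numbers. -/
def cyclicTwoPow (n : ℕ) : Set ℂ := {z | z ^ 2 ^ n = 1}

/-- The quaternion unit `i` (coordinates with respect to `1, i, j, k`). -/
def quaternionI : ℍ[ℝ] := ⟨0, 1, 0, 0⟩

/-- The quaternion unit `j`. -/
def quaternionJ : ℍ[ℝ] := ⟨0, 0, 1, 0⟩

/-- The quaternion unit `k`. -/
def quaternionK : ℍ[ℝ] := ⟨0, 0, 0, 1⟩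

/-- The set `Q_8` of the eight quaternions `±1, ±i, ±j, ±k`. -/
def quaternionEight : Set ℍ[ℝ] :=
  {1, -1, quaternionI, -quaternionI, quaternionJ, -quaternionJ, quaternionK, -quaternionK}

/-- The group of generalized quaternions `Q_{2^n}`, for `n ≥ 1`: the subgroup of the multiplicative
group of the quaternions generated by `C_{2^(n-1)} ∪ Q_8`, where `ℂ` is embedded in the quaternions
by `Quaternion.coeComplex`, that is `x + y i ↦ x + y i`. -/
def generalizedQuaternion (n : ℕ) : Subgroup (ℍ[ℝ])ˣ :=
  Subgroup.closure
    {u | (u : ℍ[ℝ]) ∈ Quaternion.coeComplex '' cyclicTwoPow (n - 1) ∪ quaternionEight}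

theorem generalizedQuaternion_mono {m n : ℕ} (h : m ≤ n) :
    generalizedQuaternion m ≤ generalizedQuaternion n := by
  refine Subgroup.closure_mono ?_
  rintro u (⟨z, hz, hu⟩ | hu)
  · refine Or.inl ⟨z, ?_, hu⟩
    have hd : 2 ^ (m - 1) ∣ 2 ^ (n - 1) := pow_dvd_pow 2 (by omega)
    obtain ⟨c, hc⟩ := hd
    have hz' : z ^ 2 ^ (m - 1) = 1 := hz
    show z ^ 2 ^ (n - 1) = 1
    rw [hc, pow_mul, hz', one_pow]
  · exact Or.inr hu

/-- The infinite group of generalized quaternions `Q_{2^∞}`: the union of the groups `Q_{2^n}`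
over all `n ≥ 1`. -/
def infiniteGeneralizedQuaternion : Subgroup (ℍ[ℝ])ˣ where
  carrier := {u | ∃ n : ℕ, 1 ≤ n ∧ u ∈ generalizedQuaternion n}
  one_mem' := ⟨1, le_rfl, one_mem _⟩
  mul_mem' := by
    rintro a b ⟨m, hm, ha⟩ ⟨n, _, hb⟩
    exact ⟨max m n, le_trans hm (le_max_left m n),
      mul_mem (generalizedQuaternion_mono (le_max_left m n) ha)
        (generalizedQuaternion_mono (le_max_right m n) hb)⟩
  inv_mem' := by
    rintro a ⟨n, hn, ha⟩
    exact ⟨n, hn, inv_mem ha⟩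

end

/-!
Let `z` be the involution of `G`. Being unique, it is central and a power of every nontrivial
element. If `x ^ 2 = z`, two elements of the centralizer of `x` with the same square differ at most
by the factor `z`; by induction on the order, of any two elements of this centralizer one is a power
of the other, so the centralizer is abelian. If `x` is taken to be the square of an element of order
eight whenever such an element exists, then `x` commutes with its conjugates, so every element of
`G` centralizes or inverts `x`. Hence the centralizer `A` of `x` has index two, and an element
outside `A` inverts all of `A` and has square `z`.

A character of `A` with values in `ℂˣ` that is nontrivial at `z` is injective, because `z` lies in
every nontrivial subgroup, and its image consists of all roots of unity of `2`-power order, because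
`A` is infinite. So `G` is the generalized dicyclic group of the Prüfer `2`-group with respect to
its involution. The same holds for the infinite generalized quaternion group, with `j` as the
inverting element, and these data determine the multiplication.
-/

section SemiconjByInv

variable {G : Type*} [Group G] {g u v x : G}

theorem sq_eq_one_of_semiconjBy_inv_of_commute (h : SemiconjBy g x x⁻¹) (hc : Commute g x) :
    x ^ 2 = 1 := by
  have hx : x = x⁻¹ := mul_right_cancel (hc.eq.symm.trans h.eq)
  rwa [eq_inv_iff_mul_eq_one, ← pow_two] at hx

theorem semiconjBy_inv_of_mem_zpowers (h : SemiconjBy g x x⁻¹) (hu : u ∈ Subgroup.zpowers x) :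
    SemiconjBy g u u⁻¹ := by
  obtain ⟨k, rfl⟩ := Subgroup.mem_zpowers_iff.1 hu
  simpa only [inv_zpow] using h.zpow_right k

theorem commute_of_mem_zpowers (h : Commute g x) (hu : u ∈ Subgroup.zpowers x) : Commute g u := by
  obtain ⟨k, rfl⟩ := Subgroup.mem_zpowers_iff.1 hu
  exact h.zpow_right k

theorem semiconjBy_mul_inv_of_sq_eq_sq (h : u ^ 2 = v ^ 2) :
    SemiconjBy u (u * v⁻¹) (u * v⁻¹)⁻¹ :=
  calc u * (u * v⁻¹) = u ^ 2 * v⁻¹ := by rw [pow_two, mul_assoc]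
    _ = v ^ 2 * v⁻¹ := by rw [h]
    _ = (u * v⁻¹)⁻¹ * u := by group

theorem semiconjBy_inv_of_mul_sq_eq_sq (h : (g * x) ^ 2 = g ^ 2) : SemiconjBy g x x⁻¹ := by
  rw [pow_two, pow_two, mul_assoc, mul_right_inj] at h
  exact eq_inv_mul_of_mul_eq h

theorem semiconjBy_inv_symm_of_sq_eq_sq (h : SemiconjBy u v v⁻¹) (huv : u ^ 2 = v ^ 2) :
    SemiconjBy v u u⁻¹ :=
  calc v * u = u⁻¹ * (u * v) * u := by group
    _ = u⁻¹ * (v⁻¹ * u ^ 2) := by rw [h.eq, pow_two]; group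
    _ = u⁻¹ * v := by rw [huv, pow_two, inv_mul_cancel_left]

theorem semiconjBy_mul_sq_inv (h : SemiconjBy g x x⁻¹) : SemiconjBy x g (g * (x ^ 2)⁻¹) :=
  calc x * g = g * x⁻¹ := by simpa only [inv_inv] using h.inv_right.eq.symm
    _ = g * (x ^ 2)⁻¹ * x := by group

theorem commute_of_commute_pow_of_coprime {p n : ℕ} (hG : IsPGroup p G) (hn : p.Coprime n)
    (h : Commute (g ^ n) x) : Commute g x := by
  obtain ⟨m, hm⟩ := exists_pow_eq_self_of_coprime (hG.orderOf_coprime hn g).symm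
  exact hm ▸ h.pow_left m

theorem index_centralizer_eq_two (h : ∀ u, Commute u x ∨ SemiconjBy u x x⁻¹)
    (hg : ¬ Commute g x) : (Subgroup.centralizer {x}).index = 2 := by
  have hginv : SemiconjBy g x x⁻¹ := (h g).resolve_left hg
  refine Subgroup.index_eq_two_iff.2 ⟨g, fun u => ?_⟩
  simp only [Subgroup.mem_centralizer_singleton_iff]
  by_cases hu : Commute u x
  · refine .inr ⟨hu.eq, fun hug => hg ?_⟩
    simpa using hu.inv_left.mul_left hug
  · refine .inl ⟨?_, hu⟩
    have hinv : SemiconjBy u x⁻¹ x := by simpa using ((h u).resolve_left hu).inv_right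
    exact (hinv.mul_left hginv).eq

end SemiconjByInv

theorem infinite_of_index_ne_zero {G : Type*} [Group G] [Infinite G] {H : Subgroup G}
    (h : H.index ≠ 0) : Infinite H :=
  not_finite_iff_infinite.1 fun hfin => not_finite_iff_infinite.2 ‹Infinite G›
    (H.finite_iff_finite_and_finiteIndex.2 ⟨hfin, ⟨h⟩⟩)

theorem range_eq_primaryComponent_of_injective {p : ℕ} [Fact p.Prime] {A K : Type*} [Group A]
    [Infinite A] [CommRing K] [IsDomain K] (hA : IsPGroup p A) {φ : A →* Kˣ}
    (hφ : Function.Injective φ) :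
    φ.range = CommGroup.primaryComponent Kˣ p := by
  refine le_antisymm ?_ fun w hw => ?_
  · rintro _ ⟨u, rfl⟩
    obtain ⟨n, hn⟩ := hA u
    exact CommGroup.mem_primaryComponent.2 ⟨n, by rw [← map_pow, hn, map_one]⟩
  obtain ⟨n, hn⟩ := CommGroup.mem_primaryComponent.1 hw
  have : NeZero p := ⟨Nat.Prime.ne_zero Fact.out⟩
  -- A bounded exponent would embed `A` in a finite group of roots of unity.
  obtain ⟨u, hu⟩ : ∃ u : A, u ^ p ^ n ≠ 1 := by
    by_contra! h
    have hroot (u : A) : φ u ∈ rootsOfUnity (p ^ n) K := by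
      rw [mem_rootsOfUnity, ← map_pow, h, map_one]
    have := Finite.of_injective (φ.codRestrict _ hroot)
      ((MonoidHom.injective_codRestrict φ _ hroot).2 hφ)
    exact not_finite A
  obtain ⟨m, hm⟩ := IsPGroup.iff_orderOf.1 hA u
  have hnm : n ≤ m := by
    by_contra! h
    exact hu (orderOf_dvd_iff_pow_eq_one.1 (hm ▸ pow_dvd_pow p h.le))
  have hprim : IsPrimitiveRoot (φ u) (p ^ m) := by
    rw [← hm, ← orderOf_injective φ hφ]
    exact IsPrimitiveRoot.orderOf _
  have hw : w ∈ Subgroup.zpowers (φ u) := by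
    rw [hprim.zpowers_eq]
    exact rootsOfUnity_le_of_dvd (pow_dvd_pow p hnm) hn
  exact Subgroup.zpowers_le.2 (MonoidHom.mem_range.2 ⟨u, rfl⟩) hw

theorem exists_extend_of_rootableBy {A D : Type*} [CommGroup A] [CommGroup D] [RootableBy D ℤ]
    (H : Subgroup A) (χ : H →* D) : ∃ φ : A →* D, ∀ h : H, φ h = χ h := by
  let : DivisibleBy (Additive D) ℤ :=
    ⟨fun a n => .ofMul (RootableBy.root a.toMul n), fun a => RootableBy.root_zero a.toMul,
      fun a hn => RootableBy.root_cancel a.toMul hn⟩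
  obtain ⟨φ, hφ⟩ := (Module.Baer.of_divisible (Additive D)).extension_property_addMonoidHom
    H.subtype.toAdditive H.subtype_injective χ.toAdditive
  exact ⟨MonoidHom.toAdditive.symm φ, fun h => congr($hφ (.ofMul h))⟩

theorem exists_monoidHom_apply_ne_one {A : Type*} (K : Type*) [CommGroup A] [Field K]
    [IsAlgClosed K] [CharZero K] {a : A} (ha : IsOfFinOrder a) (ha1 : a ≠ 1) :
    ∃ φ : A →* Kˣ, φ a ≠ 1 := by
  have hroot {n : ℕ} (hn : n ≠ 0) : Function.Surjective fun w : Kˣ => w ^ n := fun w => by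
    obtain ⟨v, hv⟩ := IsAlgClosed.exists_pow_nat_eq (w : K) (Nat.pos_of_ne_zero hn)
    have hv0 : v ≠ 0 := by
      rintro rfl
      exact w.ne_zero (by rw [← hv, zero_pow hn])
    exact ⟨Units.mk0 v hv0, by ext; simpa using hv⟩
  let : RootableBy Kˣ ℕ := rootableByOfPowLeftSurj _ _ hroot
  let : RootableBy Kˣ ℤ := Group.rootableByIntOfRootableByNat _
  have : Finite (Subgroup.zpowers a) := ha.finite_zpowers
  obtain ⟨χ, hχ⟩ := CommGroup.exists_apply_ne_one_of_hasEnoughRootsOfUnity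
    (Subgroup.zpowers a) K (a := ⟨a, Subgroup.mem_zpowers a⟩) (by simpa using ha1)
  obtain ⟨φ, hφ⟩ := exists_extend_of_rootableBy _ χ
  exact ⟨φ, fun h => hχ (by rw [← hφ, h])⟩

/-- `z` is the only element of order two of `G`. The second field, which solves `t ^ 2 = 1`, is the
form in which uniqueness is used. -/
structure IsUniqueInvolution {G : Type*} [Group G] (z : G) : Prop where
  ne_one : z ≠ 1
  sq_eq_one_iff (t : G) : t ^ 2 = 1 ↔ t = 1 ∨ t = z

namespace IsUniqueInvolution

variable {G : Type*} [Group G] {z : G} {a b c d g s t u v x : G}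

theorem of_orderOf_eq_two (hz : orderOf z = 2) (huniq : ∀ t, orderOf t = 2 → t = z) :
    IsUniqueInvolution z where
  ne_one := by
    rintro rfl
    simp at hz
  sq_eq_one_iff t := by
    refine ⟨fun ht => or_iff_not_imp_left.2 fun h => huniq t (orderOf_eq_prime ht h), ?_⟩
    rintro (rfl | rfl)
    · exact one_pow 2
    · exact hz ▸ pow_orderOf_eq_one t

theorem sq_eq_one (hz : IsUniqueInvolution z) : z ^ 2 = 1 :=
  (hz.sq_eq_one_iff z).2 (.inr rfl)

theorem inv_eq (hz : IsUniqueInvolution z) : z⁻¹ = z :=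
  inv_eq_of_mul_eq_one_right (by rw [← pow_two, hz.sq_eq_one])

theorem commute (hz : IsUniqueInvolution z) (g : G) : Commute g z := by
  have hconj : (g * z * g⁻¹) ^ 2 = 1 := by rw [conj_pow, hz.sq_eq_one, mul_one, mul_inv_cancel]
  rcases (hz.sq_eq_one_iff _).1 hconj with h | h
  · exact absurd (conj_eq_one_iff.1 h) hz.ne_one
  · exact mul_inv_eq_iff_eq_mul.1 h

theorem commute_of_sq_eq_one (hz : IsUniqueInvolution z) (ht : t ^ 2 = 1) (g : G) :
    Commute g t := by
  rcases (hz.sq_eq_one_iff t).1 ht with rfl | rfl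
  · exact .one_right g
  · exact hz.commute g

theorem mem_zpowers (hz : IsUniqueInvolution z) (h2 : IsPGroup 2 G) (hs : s ≠ 1) :
    z ∈ Subgroup.zpowers s := by
  obtain ⟨k, hk⟩ := h2 s
  induction k generalizing s with
  | zero => exact absurd (by simpa using hk) hs
  | succ k ih =>
    by_cases hs2 : s ^ 2 = 1
    · exact ((hz.sq_eq_one_iff s).1 hs2).resolve_left hs ▸ Subgroup.mem_zpowers s
    · exact Subgroup.zpowers_le.2 (Subgroup.npow_mem_zpowers s 2)
        (ih hs2 (by rw [← pow_mul, ← pow_succ', hk]))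

theorem exists_mem_zpowers_pow_eq (hz : IsUniqueInvolution z) (h2 : IsPGroup 2 G) {n : ℕ}
    (hs : s ^ n ≠ 1) : ∃ q ∈ Subgroup.zpowers s, q ^ n = z := by
  obtain ⟨k, hk⟩ := Subgroup.mem_zpowers_iff.1 (hz.mem_zpowers h2 hs)
  exact ⟨s ^ k, ⟨k, rfl⟩, by rw [← hk, ← zpow_natCast, ← zpow_natCast, zpow_comm]⟩

theorem eq_or_eq_mul_of_mul_inv_sq_eq_one (hz : IsUniqueInvolution z) (h : (u * v⁻¹) ^ 2 = 1) :
    u = v ∨ u = z * v := by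
  simpa only [mul_inv_eq_iff_eq_mul, one_mul] using (hz.sq_eq_one_iff _).1 h

theorem eq_or_eq_mul_of_sq_eq_sq (hz : IsUniqueInvolution z) (hc : Commute u v)
    (h : u ^ 2 = v ^ 2) : u = v ∨ u = z * v :=
  hz.eq_or_eq_mul_of_mul_inv_sq_eq_one <| by
    rw [hc.inv_right.mul_pow, inv_pow, h, mul_inv_cancel]

theorem not_commute_of_semiconjBy_inv (hz : IsUniqueInvolution z) (hx : x ^ 2 = z)
    (h : SemiconjBy g x x⁻¹) : ¬ Commute g x :=
  fun hc => hz.ne_one (hx ▸ sq_eq_one_of_semiconjBy_inv_of_commute h hc)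

-- `u` inverts `u * v⁻¹`, so it would invert a power of it that is a square root of `z`. That power
-- is `x` or `z * x`, since it commutes with `x`, and `u` centralizes both.
theorem eq_or_eq_mul_of_sq_eq_sq_of_commute (hz : IsUniqueInvolution z) (h2 : IsPGroup 2 G)
    (hx : x ^ 2 = z) (hu : Commute u x) (hv : Commute v x) (h : u ^ 2 = v ^ 2) :
    u = v ∨ u = z * v := by
  refine hz.eq_or_eq_mul_of_mul_inv_sq_eq_one (by_contra fun hs => ?_)
  obtain ⟨q, hq, hqz⟩ := hz.exists_mem_zpowers_pow_eq h2 hs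
  have hxq : Commute x q := commute_of_mem_zpowers (hu.mul_left hv.inv_left).symm hq
  have huq : Commute u q := by
    rcases hz.eq_or_eq_mul_of_sq_eq_sq hxq.symm (hqz.trans hx.symm) with rfl | rfl
    · exact hu
    · exact (hz.commute u).mul_right hu
  exact hz.not_commute_of_semiconjBy_inv hqz
    (semiconjBy_inv_of_mem_zpowers (semiconjBy_mul_inv_of_sq_eq_sq h) hq) huq

theorem mem_zpowers_or_mem_zpowers_of_sq_mem (hz : IsUniqueInvolution z) (h2 : IsPGroup 2 G)
    (hx : x ^ 2 = z) (hu : Commute u x) (hv : Commute v x)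
    (h : u ^ 2 ∈ Subgroup.zpowers (v ^ 2)) :
    u ∈ Subgroup.zpowers v ∨ v ∈ Subgroup.zpowers u := by
  rcases eq_or_ne v 1 with rfl | hv1
  · exact .inr (one_mem _)
  obtain ⟨k, hk⟩ := Subgroup.mem_zpowers_iff.1 h
  have hsq : u ^ 2 = (v ^ k) ^ 2 := by rw [← hk, ← zpow_natCast, ← zpow_natCast, zpow_comm]
  left
  rcases hz.eq_or_eq_mul_of_sq_eq_sq_of_commute h2 hx hu (hv.zpow_left k) hsq with rfl | rfl
  · exact ⟨k, rfl⟩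
  · exact mul_mem (hz.mem_zpowers h2 hv1) ⟨k, rfl⟩

theorem mem_zpowers_or_mem_zpowers_of_commute (hz : IsUniqueInvolution z) (h2 : IsPGroup 2 G)
    (hx : x ^ 2 = z) (hu : Commute u x) (hv : Commute v x) :
    u ∈ Subgroup.zpowers v ∨ v ∈ Subgroup.zpowers u := by
  obtain ⟨n, hn⟩ := h2 u
  induction n generalizing u v with
  | zero =>
    obtain rfl : u = 1 := by simpa using hn
    exact .inl (one_mem _)
  | succ n ih =>
    rcases ih (hu.pow_left 2) (hv.pow_left 2) (by rw [← pow_mul, ← pow_succ', hn]) with h | h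
    · exact hz.mem_zpowers_or_mem_zpowers_of_sq_mem h2 hx hu hv h
    · exact (hz.mem_zpowers_or_mem_zpowers_of_sq_mem h2 hx hv hu h).symm

theorem commute_trans (hz : IsUniqueInvolution z) (h2 : IsPGroup 2 G) (hb : b ^ 2 ≠ 1)
    (hab : Commute a b) (hbc : Commute b c) : Commute a c := by
  obtain ⟨x, hxb, hx⟩ := hz.exists_mem_zpowers_pow_eq h2 hb
  rcases hz.mem_zpowers_or_mem_zpowers_of_commute h2 hx (commute_of_mem_zpowers hab hxb)
    (commute_of_mem_zpowers hbc.symm hxb) with h | h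
  · exact (commute_of_mem_zpowers (.refl c) h).symm
  · exact commute_of_mem_zpowers (.refl a) h

theorem semiconjBy_inv_of_semiconjBy_sq_inv (hz : IsUniqueInvolution z) (h2 : IsPGroup 2 G)
    (ha : a ^ 4 = z) (hc : c ^ 2 = z) (h : SemiconjBy c (a ^ 2) (a ^ 2)⁻¹) :
    SemiconjBy c a a⁻¹ := by
  have ha2 : (a ^ 2) ^ 2 = z := by rw [← pow_mul, ha]
  have hsq : (c * a * c⁻¹) ^ 2 = a⁻¹ ^ 2 := by
    rw [conj_pow, inv_pow, mul_inv_eq_iff_eq_mul, h.eq]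
  have hconj : Commute (c * a * c⁻¹) (a ^ 2) := by
    rw [← inv_inv (a ^ 2), ← inv_pow, ← hsq]
    exact (Commute.self_pow _ 2).inv_right
  rcases hz.eq_or_eq_mul_of_sq_eq_sq_of_commute h2 ha2 hconj (Commute.self_pow a 2).inv_left hsq
    with hinv | hinv
  · exact mul_inv_eq_iff_eq_mul.1 hinv
  -- Then `c * a` has square one, so it is central, which forces `c` to commute with `a ^ 2`.
  have hca : (c * a) ^ 2 = 1 :=
    calc (c * a) ^ 2 = c * a * c⁻¹ * c ^ 2 * a := by simp only [pow_two]; group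
      _ = z * (a⁻¹ * z * a) := by rw [hinv, hc]; group
      _ = 1 := by rw [(hz.commute a⁻¹).eq, inv_mul_cancel_right, ← pow_two, hz.sq_eq_one]
  have hcomm : Commute c (a ^ 2) := by
    simpa using ((hz.commute_of_sq_eq_one hca (a ^ 2)).symm.mul_left
      (Commute.self_pow a 2).inv_left)
  exact absurd hcomm (hz.not_commute_of_semiconjBy_inv ha2 h)

-- Otherwise `a * d` would permute `a ^ 2`, `d ^ 2` and their product cyclically, like the
-- automorphism of order three of the quaternion group.
theorem not_semiconjBy_sq_inv (hz : IsUniqueInvolution z) (h2 : IsPGroup 2 G) (ha : a ^ 4 = z)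
    (hd : d ^ 4 = z) : ¬ SemiconjBy (a ^ 2) (d ^ 2) (d ^ 2)⁻¹ := by
  intro h
  have hx : (a ^ 2) ^ 2 = z := by rw [← pow_mul, ha]
  have hc : (d ^ 2) ^ 2 = z := by rw [← pow_mul, hd]
  have h' : SemiconjBy (d ^ 2) (a ^ 2) (a ^ 2)⁻¹ :=
    semiconjBy_inv_symm_of_sq_eq_sq h (hx.trans hc.symm)
  have hdx : SemiconjBy d (a ^ 2) (a ^ 2 * (d ^ 2)⁻¹) :=
    semiconjBy_mul_sq_inv (hz.semiconjBy_inv_of_semiconjBy_sq_inv h2 hd hx h)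
  have hac : SemiconjBy a (d ^ 2) (d ^ 2 * (a ^ 2)⁻¹) :=
    semiconjBy_mul_sq_inv (hz.semiconjBy_inv_of_semiconjBy_sq_inv h2 ha hc h')
  have htx : SemiconjBy (a * d) (a ^ 2) (d ^ 2) := by
    have hxc : a ^ 2 * (d ^ 2 * (a ^ 2)⁻¹)⁻¹ = d ^ 2 := by
      rw [mul_inv_rev, inv_inv, ← mul_assoc, ← pow_two, hx, ← hc, pow_two, mul_inv_cancel_right]
    exact hxc ▸ SemiconjBy.mul_left (SemiconjBy.mul_right (Commute.self_pow a 2) hac.inv_right) hdx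
  have htc : SemiconjBy (a * d) (d ^ 2) (d ^ 2 * (a ^ 2)⁻¹) := hac.mul_left (Commute.self_pow d 2)
  have htp : SemiconjBy (a * d) (d ^ 2 * (a ^ 2)⁻¹) (a ^ 2) := by
    have hcx : d ^ 2 * (a ^ 2)⁻¹ * (d ^ 2)⁻¹ = a ^ 2 := by
      simpa using mul_inv_eq_iff_eq_mul.2 h'.inv_right.eq
    simpa only [hcx] using htc.mul_right htx.inv_right
  have ht3 : Commute ((a * d) ^ 3) (a ^ 2) := by
    rw [pow_succ, pow_two]
    exact (htp.mul_left htc).mul_left htx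
  have ht : Commute (a * d) (a ^ 2) := commute_of_commute_pow_of_coprime h2 (by norm_num) ht3
  have hxc : a ^ 2 = d ^ 2 := mul_right_cancel (ht.eq.symm.trans htx.eq)
  exact hz.not_commute_of_semiconjBy_inv hc h (hxc ▸ .refl _)

theorem commute_sq_sq (hz : IsUniqueInvolution z) (h2 : IsPGroup 2 G) (ha : a ^ 4 = z)
    (hb : b ^ 4 = z) : Commute (a ^ 2) (b ^ 2) := by
  have hx : (a ^ 2) ^ 2 = z := by rw [← pow_mul, ha]
  have hy : (b ^ 2) ^ 2 = z := by rw [← pow_mul, hb]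
  have hs : SemiconjBy (a ^ 2) (a ^ 2 * (b ^ 2)⁻¹) (a ^ 2 * (b ^ 2)⁻¹)⁻¹ :=
    semiconjBy_mul_inv_of_sq_eq_sq (hx.trans hy.symm)
  by_cases hs4 : (a ^ 2 * (b ^ 2)⁻¹) ^ 4 = 1
  · have hs2 : ((a ^ 2 * (b ^ 2)⁻¹) ^ 2) ^ 2 = 1 := by rw [← pow_mul, hs4]
    rcases (hz.sq_eq_one_iff _).1 hs2 with hs1 | hsz
    · rcases hz.eq_or_eq_mul_of_mul_inv_sq_eq_one hs1 with h | h <;> rw [h]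
      exact (hz.commute _).symm.mul_left (.refl _)
    · have := semiconjBy_inv_of_mul_sq_eq_sq (hsz.trans hx.symm)
      exact absurd (by simpa using this.inv_right) (hz.not_semiconjBy_sq_inv h2 ha hb)
  · obtain ⟨d, hds, hd⟩ := hz.exists_mem_zpowers_pow_eq h2 hs4
    exact absurd (semiconjBy_inv_of_mem_zpowers hs (pow_mem hds 2))
      (hz.not_semiconjBy_sq_inv h2 ha hd)

theorem exists_sq_eq_and_commute_conj (hz : IsUniqueInvolution z) (h2 : IsPGroup 2 G)
    (hna : ∃ u v : G, ¬ Commute u v) : ∃ x, x ^ 2 = z ∧ ∀ g, Commute (g * x * g⁻¹) x := by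
  by_cases h8 : ∃ a : G, a ^ 4 = z
  · obtain ⟨a, ha⟩ := h8
    refine ⟨a ^ 2, by rw [← pow_mul, ha], fun g => ?_⟩
    rw [← conj_pow]
    exact hz.commute_sq_sq h2 (by rw [conj_pow, ha, (hz.commute g).eq, mul_inv_cancel_right]) ha
  have hsq (s : G) : (s ^ 2) ^ 2 = 1 := by
    by_contra hs
    obtain ⟨q, -, hq⟩ := hz.exists_mem_zpowers_pow_eq h2 (n := 4) (by rwa [← pow_mul] at hs)
    exact h8 ⟨q, hq⟩
  obtain ⟨u, v, huv⟩ := hna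
  obtain ⟨x, -, hx⟩ := hz.exists_mem_zpowers_pow_eq h2
    fun hv : v ^ 2 = 1 => huv (hz.commute_of_sq_eq_one hv u)
  refine ⟨x, hx, fun g => ?_⟩
  have hconj : g * x * g⁻¹ = (g * x) ^ 2 * x⁻¹ * (g ^ 2)⁻¹ := by simp only [pow_two]; group
  have hcentral (s : G) : Commute (s ^ 2) x := (hz.commute_of_sq_eq_one (hsq s) x).symm
  rw [hconj]
  exact ((hcentral _).mul_left (.inv_left (.refl x))).mul_left (hcentral g).inv_left

theorem commute_or_semiconjBy_inv (hz : IsUniqueInvolution z) (hx : x ^ 2 = z)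
    (h : Commute (g * x * g⁻¹) x) : Commute g x ∨ SemiconjBy g x x⁻¹ := by
  have hsq : (g * x * g⁻¹) ^ 2 = x ^ 2 := by
    rw [conj_pow, hx, (hz.commute g).eq, mul_inv_cancel_right]
  have hzx : z * x = x⁻¹ := by
    rw [← hz.inv_eq, ← hx, pow_two, mul_inv_rev, inv_mul_cancel_right]
  refine (hz.eq_or_eq_mul_of_sq_eq_sq h hsq).imp mul_inv_eq_iff_eq_mul.1 fun hinv => ?_
  exact mul_inv_eq_iff_eq_mul.1 (hinv.trans hzx)

theorem sq_eq_of_semiconjBy_inv (hz : IsUniqueInvolution z) (h2 : IsPGroup 2 G) (hx : x ^ 2 = z)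
    (h : SemiconjBy g x x⁻¹) : g ^ 2 = z := by
  have hgx : ¬ Commute g x := hz.not_commute_of_semiconjBy_inv hx h
  have hg2x : Commute (g ^ 2) x := by
    rw [pow_two]
    exact SemiconjBy.mul_left (by simpa using h.inv_right) h
  have hg4 : (g ^ 2) ^ 2 = 1 := by
    by_contra hne
    exact hgx (hz.commute_trans h2 hne (Commute.self_pow g 2) hg2x)
  exact ((hz.sq_eq_one_iff _).1 hg4).resolve_left
    fun hg => hgx (hz.commute_of_sq_eq_one hg x).symm

theorem semiconjBy_inv_of_commute (hz : IsUniqueInvolution z) (h2 : IsPGroup 2 G) (hx : x ^ 2 = z)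
    (hg : SemiconjBy g x x⁻¹) (hb : Commute b x) : SemiconjBy g b b⁻¹ :=
  semiconjBy_inv_of_mul_sq_eq_sq <|
    (hz.sq_eq_of_semiconjBy_inv h2 hx (hg.mul_left hb)).trans
      (hz.sq_eq_of_semiconjBy_inv h2 hx hg).symm

theorem exists_semiconjBy_inv_and_index_centralizer (hz : IsUniqueInvolution z)
    (h2 : IsPGroup 2 G) (hna : ∃ u v : G, ¬ Commute u v) :
    ∃ x g, x ^ 2 = z ∧ SemiconjBy g x x⁻¹ ∧ (Subgroup.centralizer {x}).index = 2 := by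
  obtain ⟨x, hx, hconj⟩ := hz.exists_sq_eq_and_commute_conj h2 hna
  have hcases (u : G) := hz.commute_or_semiconjBy_inv hx (hconj u)
  obtain ⟨g, hg⟩ : ∃ g, ¬ Commute g x := by
    by_contra! h
    obtain ⟨u, v, huv⟩ := hna
    exact huv (hz.commute_trans h2 (hx ▸ hz.ne_one) (h u) (h v).symm)
  exact ⟨x, g, hx, (hcases g).resolve_left hg, index_centralizer_eq_two hcases hg⟩

theorem subgroup (hz : IsUniqueInvolution z) {H : Subgroup G} (hzH : z ∈ H) :
    IsUniqueInvolution (⟨z, hzH⟩ : H) where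
  ne_one h := hz.ne_one congr(($h : G))
  sq_eq_one_iff t := by
    rw [Subtype.ext_iff, Subtype.ext_iff, Subtype.ext_iff]
    exact hz.sq_eq_one_iff t

end IsUniqueInvolution

theorem IsUniqueInvolution.injective_of_apply_ne_one {G M : Type*} [Group G] [Monoid M] {z : G}
    (hz : IsUniqueInvolution z) (h2 : IsPGroup 2 G) {φ : G →* M} (h : φ z ≠ 1) :
    Function.Injective φ := by
  refine (injective_iff_map_eq_one φ).2 fun u hu => by_contra fun hu1 => h ?_
  exact Subgroup.zpowers_le.2 (φ.mem_ker.2 hu) (hz.mem_zpowers h2 hu1)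

theorem IsUniqueInvolution.exists_mulEquiv_primaryComponent {A : Type*} (K : Type*) [CommGroup A]
    [Infinite A] [Field K] [IsAlgClosed K] [CharZero K] {z : A} (hz : IsUniqueInvolution z)
    (h2 : IsPGroup 2 A) :
    ∃ e : A ≃* CommGroup.primaryComponent Kˣ 2, (e z : Kˣ) = -1 := by
  obtain ⟨φ, hφz⟩ := exists_monoidHom_apply_ne_one K
    (isOfFinOrder_iff_pow_eq_one.2 ⟨2, two_pos, hz.sq_eq_one⟩) hz.ne_one
  have hφ := hz.injective_of_apply_ne_one h2 hφz
  refine ⟨(MonoidHom.ofInjective hφ).trans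
    (MulEquiv.subgroupCongr (range_eq_primaryComponent_of_injective h2 hφ)), ?_⟩
  have hsq : φ z ^ 2 = 1 ^ 2 := by rw [← map_pow, hz.sq_eq_one, map_one, one_pow]
  exact (Units.eq_or_eq_neg_of_sq_eq_sq _ _ hsq).resolve_left hφz

/-- `f` and `g` exhibit inside `G` the generalized dicyclic group of the abelian group `K` with
respect to `y`: the element `g` lies outside the image of `K`, inverts it, and has square `y`. -/
structure IsDicyclic {K G : Type*} [CommGroup K] [Group G] (y : K) (f : K →* G) (g : G) : Prop where
  injective : Function.Injective f
  notMem_range : g ∉ f.range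
  semiconjBy (k : K) : SemiconjBy g (f k) (f k)⁻¹
  mul_self : g * g = f y

/-- The multiplication of the generalized dicyclic group of `K` with respect to `y`, where `inl k`
stands for `k` and `inr k` for `k * g`. -/
def dicyclicMul {K : Type*} [CommGroup K] (y : K) : K ⊕ K → K ⊕ K → K ⊕ K
  | .inl k, .inl l => .inl (k * l)
  | .inl k, .inr l => .inr (k * l)
  | .inr k, .inl l => .inr (k * l⁻¹)
  | .inr k, .inr l => .inl (k * l⁻¹ * y)

/-- The element of `G` encoded by an element of `K ⊕ K` in the normal form of `dicyclicMul`. -/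
def dicyclicEval {K G : Type*} [CommGroup K] [Group G] (f : K →* G) (g : G) : K ⊕ K → G :=
  Sum.elim f fun k => f k * g

namespace IsDicyclic

variable {K G G' : Type*} [CommGroup K] [Group G] [Group G'] {y : K} {f : K →* G} {g : G}
  {f' : K →* G'} {g' : G'}

theorem dicyclicEval_injective (h : IsDicyclic y f g) : Function.Injective (dicyclicEval f g) := by
  refine h.injective.sumElim (fun k l hkl => h.injective (mul_right_cancel hkl)) fun k l hkl => ?_
  exact h.notMem_range ⟨l⁻¹ * k, by rw [map_mul, hkl, map_inv, inv_mul_cancel_left]⟩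

theorem dicyclicEval_mul (h : IsDicyclic y f g) (s t : K ⊕ K) :
    dicyclicEval f g (dicyclicMul y s t) = dicyclicEval f g s * dicyclicEval f g t := by
  have hsemi (k l : K) : f k * g * f l = f (k * l⁻¹) * g := by
    rw [mul_assoc, (h.semiconjBy l).eq, map_mul, map_inv, mul_assoc]
  rcases s with k | k <;> rcases t with l | l <;>
    simp only [dicyclicEval, dicyclicMul, Sum.elim_inl, Sum.elim_inr]
  · exact map_mul f k l
  · rw [map_mul, mul_assoc]
  · exact (hsemi k l).symm
  · rw [← mul_assoc, hsemi, map_mul f _ y, ← h.mul_self, mul_assoc]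

/-- The subgroup `f(K) ∪ f(K)g`, a copy of the generalized dicyclic group. -/
def subgroup (h : IsDicyclic y f g) : Subgroup G where
  carrier := Set.range (dicyclicEval f g)
  one_mem' := ⟨.inl 1, map_one f⟩
  mul_mem' := by
    rintro _ _ ⟨s, rfl⟩ ⟨t, rfl⟩
    exact ⟨dicyclicMul y s t, h.dicyclicEval_mul s t⟩
  inv_mem' := by
    rintro _ ⟨k | k, rfl⟩
    · exact ⟨.inl k⁻¹, map_inv f k⟩
    · refine ⟨.inr (k * y⁻¹), eq_inv_of_mul_eq_one_left ?_⟩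
      rw [← h.dicyclicEval_mul]
      simp [dicyclicMul, dicyclicEval]

theorem mem_subgroup (h : IsDicyclic y f g) {u : G} :
    u ∈ h.subgroup ↔ (∃ k, f k = u) ∨ ∃ k, f k * g = u :=
  Sum.exists

theorem subgroup_eq_top (h : IsDicyclic y f g) (hindex : f.range.index = 2) :
    h.subgroup = ⊤ := by
  refine eq_top_iff.2 fun u _ => h.mem_subgroup.2 (or_iff_not_imp_left.2 fun hu => ?_)
  obtain ⟨k, hk⟩ : u * g⁻¹ ∈ f.range := (Subgroup.mul_mem_iff_of_index_two hindex).2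
    (iff_of_false hu (mt f.range.inv_mem_iff.1 h.notMem_range))
  exact ⟨k, by rw [hk, inv_mul_cancel_right]⟩

/-- The normal form in a generalized dicyclic group. -/
noncomputable def equivSum (h : IsDicyclic y f g) : K ⊕ K ≃ h.subgroup :=
  Equiv.ofInjective _ h.dicyclicEval_injective

theorem equivSum_mul (h : IsDicyclic y f g) (s t : K ⊕ K) :
    h.equivSum (dicyclicMul y s t) = h.equivSum s * h.equivSum t :=
  Subtype.ext (h.dicyclicEval_mul s t)

/-- The isomorphism between two copies of the same generalized dicyclic group that matches normal
forms. -/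
noncomputable def mulEquiv (h : IsDicyclic y f g) (h' : IsDicyclic y f' g') :
    h.subgroup ≃* h'.subgroup :=
  MulEquiv.mk' (h.equivSum.symm.trans h'.equivSum) fun u v => by
    obtain ⟨s, rfl⟩ := h.equivSum.surjective u
    obtain ⟨t, rfl⟩ := h.equivSum.surjective v
    simp only [← equivSum_mul, Equiv.trans_apply, Equiv.symm_apply_apply]

end IsDicyclic

/-- The Prüfer `2`-group, realised as the union of the groups `C_{2^n}` of complex numbers. -/
abbrev pruferTwoGroup : Subgroup ℂˣ := CommGroup.primaryComponent ℂˣ 2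

/-- The involution `-1` of the Prüfer `2`-group. -/
def pruferNegOne : pruferTwoGroup := ⟨-1, 1, by simp⟩

theorem IsUniqueInvolution.exists_isDicyclic {G : Type*} [Group G] [Infinite G] {z : G}
    (hz : IsUniqueInvolution z) (h2 : IsPGroup 2 G) (hna : ∃ u v : G, ¬ Commute u v) :
    ∃ (f : pruferTwoGroup →* G) (g : G) (h : IsDicyclic pruferNegOne f g), h.subgroup = ⊤ := by
  obtain ⟨x, g, hx, hg, hindex⟩ := hz.exists_semiconjBy_inv_and_index_centralizer h2 hna
  set A := Subgroup.centralizer {x}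
  have mem_A {u : G} : u ∈ A ↔ Commute u x := Subgroup.mem_centralizer_singleton_iff
  have hzA : z ∈ A := mem_A.2 (hz.commute x).symm
  have : Infinite A := infinite_of_index_ne_zero (by simp [hindex])
  let : CommGroup A :=
    { mul_comm u v := Subtype.ext <|
        hz.commute_trans h2 (hx ▸ hz.ne_one) (mem_A.1 u.2) (mem_A.1 v.2).symm }
  obtain ⟨e, he⟩ := (hz.subgroup hzA).exists_mulEquiv_primaryComponent ℂ (h2.to_subgroup A)
  have hrange : (A.subtype.comp e.symm.toMonoidHom).range = A := by
    rw [MonoidHom.range_comp, MonoidHom.range_eq_top.2 e.symm.surjective,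
      ← MonoidHom.range_eq_map, A.range_subtype]
  have hdic : IsDicyclic pruferNegOne (A.subtype.comp e.symm.toMonoidHom) g :=
    { injective := A.subtype_injective.comp e.symm.injective
      notMem_range := by
        rw [hrange, mem_A]
        exact hz.not_commute_of_semiconjBy_inv hx hg
      semiconjBy k := hz.semiconjBy_inv_of_commute h2 hx hg (mem_A.1 (e.symm k).2)
      mul_self := by
        have hez : e.symm pruferNegOne = ⟨z, hzA⟩ := e.symm_apply_eq.2 (Subtype.ext he.symm)
        simp [hez, ← pow_two, hz.sq_eq_of_semiconjBy_inv h2 hx hg] }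
  exact ⟨_, g, hdic, hdic.subgroup_eq_top (by rw [hrange, hindex])⟩

attribute [simps] quaternionI quaternionJ quaternionK

/-- The embedding of the Prüfer `2`-group into the multiplicative group of the quaternions. -/
noncomputable def pruferToQuaternion : pruferTwoGroup →* (ℍ[ℝ])ˣ :=
  (Units.map (Quaternion.ofComplex : ℂ →* ℍ[ℝ])).comp pruferTwoGroup.subtype

theorem coe_pruferToQuaternion (w : pruferTwoGroup) :
    (pruferToQuaternion w : ℍ[ℝ]) = Quaternion.coeComplex (w : ℂˣ) := rfl

theorem pruferToQuaternion_injective : Function.Injective pruferToQuaternion :=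
  (Units.map_injective Quaternion.ofComplex.toRingHom.injective).comp Subtype.val_injective

theorem pruferToQuaternion_pruferNegOne : pruferToQuaternion pruferNegOne = -1 := by
  ext <;> simp [coe_pruferToQuaternion, pruferNegOne]

theorem norm_eq_one_of_mem_pruferTwoGroup {w : ℂˣ} (hw : w ∈ pruferTwoGroup) :
    ‖(w : ℂ)‖ = 1 := by
  obtain ⟨n, hn⟩ := CommGroup.mem_primaryComponent.1 hw
  exact Complex.norm_eq_one_of_pow_eq_one (congr(($hn : ℂ))) (by positivity)

/-- The quaternion `j` as an element of the multiplicative group. -/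
def quaternionJUnit : (ℍ[ℝ])ˣ where
  val := quaternionJ
  inv := -quaternionJ
  val_inv := by ext <;> simp
  inv_val := by ext <;> simp

/-- The quaternion `i` as an element of the Prüfer `2`-group. -/
noncomputable def pruferI : pruferTwoGroup :=
  ⟨Units.mk0 Complex.I Complex.I_ne_zero, 2, by ext; simp⟩

theorem coe_pruferToQuaternion_pruferI : (pruferToQuaternion pruferI : ℍ[ℝ]) = quaternionI := by
  ext <;> simp [coe_pruferToQuaternion, pruferI]

theorem isDicyclic_quaternion :
    IsDicyclic pruferNegOne pruferToQuaternion quaternionJUnit where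
  injective := pruferToQuaternion_injective
  notMem_range := by
    rintro ⟨w, hw⟩
    simpa [coe_pruferToQuaternion, quaternionJUnit] using
      congr(($hw : ℍ[ℝ]).imJ)
  semiconjBy w := by
    rw [SemiconjBy, ← map_inv]
    ext1
    rw [Units.val_mul, Units.val_mul, coe_pruferToQuaternion, coe_pruferToQuaternion,
      Subgroup.coe_inv, Units.val_inv_eq_inv_val,
      Complex.inv_eq_conj (norm_eq_one_of_mem_pruferTwoGroup w.2)]
    ext <;> simp [quaternionJUnit]
  mul_self := by
    rw [pruferToQuaternion_pruferNegOne]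
    ext <;> simp [quaternionJUnit]

theorem mem_subgroup_of_mem_quaternionEight {u : (ℍ[ℝ])ˣ} (hu : (u : ℍ[ℝ]) ∈ quaternionEight) :
    u ∈ isDicyclic_quaternion.subgroup := by
  have hi : pruferToQuaternion pruferI ∈ isDicyclic_quaternion.subgroup :=
    isDicyclic_quaternion.mem_subgroup.2 (.inl ⟨_, rfl⟩)
  have hj : quaternionJUnit ∈ isDicyclic_quaternion.subgroup :=
    isDicyclic_quaternion.mem_subgroup.2 (.inr ⟨1, by simp⟩)
  have hk : (pruferToQuaternion pruferI * quaternionJUnit : (ℍ[ℝ])ˣ) = quaternionK := by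
    rw [Units.val_mul, coe_pruferToQuaternion_pruferI]
    ext <;> simp [quaternionJUnit]
  have hneg_one : -1 ∈ isDicyclic_quaternion.subgroup :=
    isDicyclic_quaternion.mem_subgroup.2 (.inl ⟨_, pruferToQuaternion_pruferNegOne⟩)
  have mem_of_eq {v : (ℍ[ℝ])ˣ} (hv : v ∈ isDicyclic_quaternion.subgroup) {q : ℍ[ℝ]}
      (hvq : v = q) (huq : u = q) : u ∈ isDicyclic_quaternion.subgroup :=
    Units.ext (huq.trans hvq.symm) ▸ hv
  have mem_of_eq_neg {v : (ℍ[ℝ])ˣ} (hv : v ∈ isDicyclic_quaternion.subgroup) {q : ℍ[ℝ]}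
      (hvq : v = q) (huq : u = -q) : u ∈ isDicyclic_quaternion.subgroup :=
    mem_of_eq (mul_mem hneg_one hv) (by simp [hvq]) huq
  rcases hu with h | h | h | h | h | h | h | h
  · exact mem_of_eq (one_mem _) rfl h
  · exact mem_of_eq_neg (one_mem _) rfl h
  · exact mem_of_eq hi coe_pruferToQuaternion_pruferI h
  · exact mem_of_eq_neg hi coe_pruferToQuaternion_pruferI h
  · exact mem_of_eq hj rfl h
  · exact mem_of_eq_neg hj rfl h
  · exact mem_of_eq (mul_mem hi hj) hk h
  · exact mem_of_eq_neg (mul_mem hi hj) hk h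

theorem subgroup_isDicyclic_quaternion :
    isDicyclic_quaternion.subgroup = infiniteGeneralizedQuaternion := by
  refine le_antisymm (fun u hu => ?_) ?_
  · have hmem (w : pruferTwoGroup) : pruferToQuaternion w ∈ infiniteGeneralizedQuaternion := by
      obtain ⟨n, hn⟩ := CommGroup.mem_primaryComponent.1 w.2
      refine ⟨n + 1, by omega, Subgroup.subset_closure (.inl ⟨_, ?_, rfl⟩)⟩
      exact congr(($hn : ℂ))
    have hj : quaternionJUnit ∈ infiniteGeneralizedQuaternion :=
      ⟨1, le_rfl, Subgroup.subset_closure (.inr (by simp [quaternionEight, quaternionJUnit]))⟩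
    rcases isDicyclic_quaternion.mem_subgroup.1 hu with ⟨w, rfl⟩ | ⟨w, rfl⟩
    · exact hmem w
    · exact mul_mem (hmem w) hj
  · rintro u ⟨n, -, hu⟩
    refine (Subgroup.closure_le _).2 ?_ hu
    rintro v (⟨w, hw, hv⟩ | hv)
    · have hw1 : w ^ 2 ^ (n - 1) = 1 := hw
      have hunit : IsUnit w := .of_pow_eq_one hw1 (by positivity)
      refine isDicyclic_quaternion.mem_subgroup.2 (.inl ⟨⟨hunit.unit, n - 1, ?_⟩, Units.ext hv⟩)
      ext
      simpa using hw1
    · exact mem_subgroup_of_mem_quaternionEight hv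

theorem lemma12 {G : Type*} [Group G] [Infinite G] (h2 : IsPGroup 2 G)
    (hna : ¬ ∀ a b : G, a * b = b * a) (hu : ∃! x : G, orderOf x = 2) :
    Nonempty (G ≃* infiniteGeneralizedQuaternion) := by
  obtain ⟨z, hz, huniq⟩ := hu
  have hinv : IsUniqueInvolution z := .of_orderOf_eq_two hz huniq
  obtain ⟨f, g, h, htop⟩ := hinv.exists_isDicyclic h2 (by simpa [Commute, SemiconjBy] using hna)
  exact ⟨Subgroup.topEquiv.symm.trans <| (MulEquiv.subgroupCongr htop.symm).trans <|
    (h.mulEquiv isDicyclic_quaternion).trans <|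
    MulEquiv.subgroupCongr subgroup_isDicyclic_quaternion⟩
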